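/- Let $N\ge 1$ and let $(\xi_1,\eta_1),\dots,(\xi_N,\eta_N)$ be independent and identically distributed random vectors in $\mathbb{R}^2$. Let $\pi$ be a random permutation of $\{1,\dots,N\}$ with $\xi_{\pi(1)}\le\xi_{\pi(2)}\le\dots\le\xi_{\pi(N)}$, where ties are broken without reference to the $\eta_i$: $\pi$ is a measurable function of $(\xi_1,\dots,\xi_N)$ and of a random element $V$ that is independent of $(\xi_i,\eta_i)_{i\le N}$ (for instance, ties are broken by index, or uniformly at random). The induced order statistics (concomitants) are $\eta_{[j:N]}=\eta_{\pi(j)}$, $j=1,\dots,N$. A random vector $\mathbf X=(X_1,\dots,X_d)$ is called positively (negatively) regression dependent, PRD (NRD), if for every $i$ and every coordinatewise increasing function $g:\mathbb{R}^{d-1}\to\mathbb{R}$ such that $g(\mathbf X_{-i})$ is integrable, the conditional expectation $\mathbb{E}[g(\mathbf X_{-i})\mid X_i]$ is almost surely an increasing (decreasing) function of $X_i$; here $\mathbf X_{-i}$ is $\mathbf X$ without its $i$-th coordinate, and "increasing" and "decreasing" are meant in the non-strict sense. Let $k\ge 0$ be an integer. If $\mathbb{E}|\eta_1|^{2k+1}<\infty$,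 then $\mathbb{E}|\eta_{[j:N]}|^{2k+1}<\infty$ for all $j$. If $(\xi_1,\eta_1)$ is PRD, then $$\mathbb{E}\big[\eta_{[1:N]}^{2k+1}\big]\le \mathbb{E}\big[\eta_{[2:N]}^{2k+1}\big]\le\dots\le \mathbb{E}\big[\eta_{[N:N]}^{2k+1}\big],$$ and if $(\xi_1,\eta_1)$ is NRD, then $$\mathbb{E}\big[\eta_{[1:N]}^{2k+1}\big]\ge \mathbb{E}\big[\eta_{[2:N]}^{2k+1}\big]\ge\dots\ge \mathbb{E}\big[\eta_{[N:N]}^{2k+1}\big].$$ If $\mathbb{E}|\eta_1|^{2k+1}=\infty$, these inequalities are claimed between any two of the moments $\mathbb{E}[\eta_{[j:N]}^{2k+1}]$ that are finite, that is, those with $\mathbb{E}|\eta_{[j:N]}|^{2k+1}<\infty$. -/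

import Mathlib

open MeasureTheory ProbabilityTheory

/-- The subvector of `x` obtained by deleting the coordinate `i`. -/
def dropCoord {d : ℕ} (x : Fin d → ℝ) (i : Fin d) : {l : Fin d // l ≠ i} → ℝ :=
  fun l => x l

/-- Positive regression dependence of a random vector `X`: for every coordinate `i` and every
coordinatewise increasing `g` with `g (X₋ᵢ)` integrable, `E[g (X₋ᵢ) | Xᵢ]` is almost surely an
increasing function of `Xᵢ`. The function `m` is only asked to be increasing on a set `A` that
carries `Xᵢ`, as it may tend to `±∞` at the ends of the range of `Xᵢ`. -/
def IsPRD {Ω : Type*} [MeasurableSpace Ω] {d : ℕ} (P : Measure Ω) (X : Ω → Fin d → ℝ) : Prop :=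
  ∀ (i : Fin d) (g : ({l : Fin d // l ≠ i} → ℝ) → ℝ), Monotone g →
    Integrable (fun ω => g (dropCoord (X ω) i)) P →
    ∃ (m : ℝ → ℝ) (A : Set ℝ), (∀ᵐ ω ∂P, X ω i ∈ A) ∧ MonotoneOn m A ∧
      P[fun ω => g (dropCoord (X ω) i) | MeasurableSpace.comap (fun ω => X ω i) inferInstance]
        =ᵐ[P] fun ω => m (X ω i)

/-- Negative regression dependence: as `IsPRD`, with a decreasing function of `Xᵢ`. -/
def IsNRD {Ω : Type*} [MeasurableSpace Ω] {d : ℕ} (P : Measure Ω) (X : Ω → Fin d → ℝ) : Prop :=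
  ∀ (i : Fin d) (g : ({l : Fin d // l ≠ i} → ℝ) → ℝ), Monotone g →
    Integrable (fun ω => g (dropCoord (X ω) i)) P →
    ∃ (m : ℝ → ℝ) (A : Set ℝ), (∀ᵐ ω ∂P, X ω i ∈ A) ∧ AntitoneOn m A ∧
      P[fun ω => g (dropCoord (X ω) i) | MeasurableSpace.comap (fun ω => X ω i) inferInstance]
        =ᵐ[P] fun ω => m (X ω i)

/-- A measurable rule that ranks `N` real numbers in increasing order. The parameter `t : T` is an
auxiliary randomization that the rule may use to break ties: `perm x t j` is the index of the
entry of `x` put at rank `j`. For `T = Unit` the ties are broken deterministically, for example by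
index. -/
structure RankingRule (N : ℕ) (T : Type*) [MeasurableSpace T] where
  perm : (Fin N → ℝ) → T → Equiv.Perm (Fin N)
  measurableSet_perm_eq : ∀ σ : Equiv.Perm (Fin N),
    MeasurableSet {p : (Fin N → ℝ) × T | perm p.1 p.2 = σ}
  sorted : ∀ (x : Fin N → ℝ) (t : T), Monotone fun j => x (perm x t j)

/-- The induced order statistic (concomitant) `η_[j:N]`: the value `η_i` for the index `i` whose
`ξ_i` has rank `j` among `ξ_1, …, ξ_N`, with ties broken by the rule `R` and the
randomization `V`. Ranks are counted from `0`. -/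
def inducedOrderStat {Ω T : Type*} [MeasurableSpace T] {N : ℕ} (R : RankingRule N T)
    (ξ η : Fin N → Ω → ℝ) (V : Ω → T) (j : Fin N) (ω : Ω) : ℝ :=
  η (R.perm (fun i => ξ i ω) (V ω) j) ω

/-! Let `g` be bounded and increasing, with `E[g(η_i) | ξ_i] = M(ξ_i)` and `M` increasing. Whether
`i` has rank `j` depends only on `ξ_i` and on data independent of `(ξ_i, η_i)`, so on that event
`g(η_i)` may be replaced by `M(ξ_i)` under the expectation. Summing over `i` gives `E[g(η_[j:N])] =
E[M(ξ_(j))]` (`integral_comp_inducedOrderStat`), which increases with `j` because the order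
statistics do so pointwise. The odd power is unbounded, so this is applied to its truncations.
Dominated convergence then needs only the two compared moments to be finite, not those of `η_i`. The
NRD case is the same argument for `-g`. -/

/-! ### Monotone regression functions and freezing of independent data. -/

section ConditionalExpectation

variable {Ω : Type*} [MeasurableSpace Ω] {P : Measure Ω} [IsProbabilityMeasure P]

/-- If a bounded random variable has a conditional expectation given `X` that is an increasing
function of `X` on a set carrying `X`, then this function may be taken increasing and bounded on
the whole line. -/
lemma exists_monotone_version_of_condExp {X f : Ω → ℝ} (hX : Measurable X) (hf : Measurable f)
    {C : ℝ} (hC : 0 ≤ C) (hfC : ∀ ω, |f ω| ≤ C) {m : ℝ → ℝ} {A : Set ℝ}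
    (hA : ∀ᵐ ω ∂P, X ω ∈ A) (hm : MonotoneOn m A)
    (hcond : P[f | MeasurableSpace.comap X inferInstance] =ᵐ[P] fun ω => m (X ω)) :
    ∃ M : ℝ → ℝ, Monotone M ∧ (∀ x, |M x| ≤ C) ∧
      ∀ B, MeasurableSet B → ∫ ω in X ⁻¹' B, f ω ∂P = ∫ ω in X ⁻¹' B, M (X ω) ∂P := by
  have hfi : Integrable f P := Integrable.of_bound hf.aestronglyMeasurable C (ae_of_all _ hfC)
  have hbd : ∀ᵐ ω ∂P, |(P[f | MeasurableSpace.comap X inferInstance]) ω| ≤ C :=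
    ae_bdd_abs_condExp_of_ae_bdd_abs (ae_of_all _ hfC)
  -- A monotone extension to the whole line needs a bounded image; the discarded points have
  -- probability zero under the law of `X`, by `hcond` and `hbd`.
  have hm' : MonotoneOn m (A ∩ {x | |m x| ≤ C}) := hm.mono Set.inter_subset_left
  obtain ⟨g, hg, hgm⟩ := hm'.exists_monotone_extension
    ⟨-C, by rintro _ ⟨x, hx, rfl⟩; exact (abs_le.1 hx.2).1⟩
    ⟨C, by rintro _ ⟨x, hx, rfl⟩; exact (abs_le.1 hx.2).2⟩
  -- Clamping bounds the extension everywhere and changes nothing on the carrying set.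
  refine ⟨fun x => max (-C) (min C (g x)), ?_, ?_, ?_⟩
  · intro x y hxy
    exact max_le_max le_rfl (min_le_min le_rfl (hg hxy))
  · intro x
    rw [abs_le]
    exact ⟨le_max_left _ _, max_le (by linarith) (min_le_left _ _)⟩
  · intro B hB
    rw [← setIntegral_condExp hX.comap_le hfi ⟨B, hB, rfl⟩]
    refine setIntegral_congr_ae (hX hB) ?_
    filter_upwards [hA, hcond, hbd] with ω h1 h2 h3 _
    rw [h2] at h3 ⊢
    have := abs_le.1 h3
    rw [← hgm ⟨h1, h3⟩, min_eq_right this.2, max_eq_right this.1]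

/-- If `V` is independent of `(X, Y)` and `X` is independent of `Y`, then `X` is independent
of `(Y, V)`. -/
lemma IndepFun.prodMk_right_of_prodMk_left {α β γ : Type*} [MeasurableSpace α]
    [MeasurableSpace β] [MeasurableSpace γ] {X : Ω → α} {Y : Ω → β} {V : Ω → γ}
    (hX : Measurable X) (hY : Measurable Y) (hV : Measurable V) (hXY : IndepFun X Y P)
    (hV' : IndepFun (fun ω => (X ω, Y ω)) V P) : IndepFun X (fun ω => (Y ω, V ω)) P := by
  have hYV : IndepFun Y V P := hV'.comp measurable_snd measurable_id
  rw [indepFun_iff_map_prod_eq_prod_map_map hX.aemeasurable (hY.prodMk hV).aemeasurable,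
    hYV.map_prod_eq_prod_map_map hY.aemeasurable hV.aemeasurable, ← Measure.prodAssoc_prod,
    ← hXY.map_prod_eq_prod_map_map hX.aemeasurable hY.aemeasurable,
    ← hV'.map_prod_eq_prod_map_map (hX.prodMk hY).aemeasurable hV.aemeasurable,
    Measure.map_map (MeasurableEquiv.measurable _) ((hX.prodMk hY).prodMk hV)]
  rfl

/-- Freezing lemma: if `D` integrates to zero over every event determined by the first coordinate
of `Z`, it does so over every event determined by that coordinate and an independent `W`. -/
lemma IndepFun.integral_indicator_eq_zero {β : Type*} [MeasurableSpace β] {Z : Ω → ℝ × ℝ}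
    {W : Ω → β} (hZ : Measurable Z) (hW : Measurable W) (hZW : IndepFun Z W P) {D : ℝ × ℝ → ℝ}
    (hD : Measurable D) {C : ℝ} (hDC : ∀ z, |D z| ≤ C)
    (h0 : ∀ B, MeasurableSet B → ∫ z in Prod.fst ⁻¹' B, D z ∂(P.map Z) = 0)
    {S : Set (ℝ × β)} (hS : MeasurableSet S) :
    ∫ ω, {ω | ((Z ω).1, W ω) ∈ S}.indicator (fun ω => D (Z ω)) ω ∂P = 0 := by
  have := Measure.isProbabilityMeasure_map (μ := P) hZ.aemeasurable
  have := Measure.isProbabilityMeasure_map (μ := P) hW.aemeasurable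
  set S' : Set ((ℝ × ℝ) × β) := {p | (p.1.1, p.2) ∈ S} with hS'
  have hS'm : MeasurableSet S' :=
    (by fun_prop : Measurable fun p : (ℝ × ℝ) × β => (p.1.1, p.2)) hS
  set F : (ℝ × ℝ) × β → ℝ := S'.indicator fun p => D p.1
  have hF : Measurable F := (hD.comp measurable_fst).indicator hS'm
  have hFC : ∀ p, ‖F p‖ ≤ C := fun p =>
    (norm_indicator_le_norm_self _ _).trans (hDC p.1)
  calc ∫ ω, {ω | ((Z ω).1, W ω) ∈ S}.indicator (fun ω => D (Z ω)) ω ∂P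
      = ∫ ω, F (Z ω, W ω) ∂P := rfl
    _ = ∫ p, F p ∂(P.map fun ω => (Z ω, W ω)) :=
        (integral_map (hZ.prodMk hW).aemeasurable hF.aestronglyMeasurable).symm
    _ = ∫ p, F p ∂((P.map Z).prod (P.map W)) := by
        rw [hZW.map_prod_eq_prod_map_map hZ.aemeasurable hW.aemeasurable]
    _ = ∫ w, ∫ z, F (z, w) ∂(P.map Z) ∂(P.map W) :=
        integral_prod_symm _
          (Integrable.of_bound hF.aestronglyMeasurable C (ae_of_all _ hFC))
    _ = 0 := by
        -- For fixed `w` the section of `S` constrains only the first coordinate of `z`, so `h0`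
        -- applies.
        refine integral_eq_zero_of_ae (ae_of_all _ fun w => ?_)
        have hB : MeasurableSet {x | (x, w) ∈ S} := measurable_prodMk_right hS
        rw [Pi.zero_apply, ← h0 _ hB, ← integral_indicator (measurable_fst hB)]
        rfl

end ConditionalExpectation

/-! ### Concomitants as sums over rank events. -/

section InducedOrderStat

variable {Ω T : Type*} [MeasurableSpace T] {N : ℕ}

lemma RankingRule.measurableSet_perm_apply_eq (R : RankingRule N T) (j i : Fin N) :
    MeasurableSet {p : (Fin N → ℝ) × T | R.perm p.1 p.2 j = i} := by
  have : {p : (Fin N → ℝ) × T | R.perm p.1 p.2 j = i} =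
      ⋃ σ : Equiv.Perm (Fin N), ⋃ _ : σ j = i, {p | R.perm p.1 p.2 = σ} := by
    ext p
    simp
  rw [this]
  exact .iUnion fun σ => .iUnion fun _ => R.measurableSet_perm_eq σ

/-- The event that the index `i` has rank `j`. -/
def rankEvent (R : RankingRule N T) (ξ : Fin N → Ω → ℝ) (V : Ω → T) (j i : Fin N) : Set Ω :=
  {ω | R.perm (fun l => ξ l ω) (V ω) j = i}

/-- Exactly one index has rank `j`, so the random index becomes a sum over fixed ones. Taking `ζ =
ξ` covers the order statistics themselves. -/
lemma comp_inducedOrderStat_eq_sum (R : RankingRule N T) (ξ ζ : Fin N → Ω → ℝ) (V : Ω → T)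
    (g : ℝ → ℝ) (j : Fin N) (ω : Ω) :
    g (inducedOrderStat R ξ ζ V j ω) =
      ∑ i, (rankEvent R ξ V j i).indicator (fun ω => g (ζ i ω)) ω := by
  simp [Set.indicator_apply, rankEvent, inducedOrderStat]

variable [MeasurableSpace Ω]

lemma measurableSet_rankEvent (R : RankingRule N T) {ξ : Fin N → Ω → ℝ} {V : Ω → T}
    (hξ : ∀ i, Measurable (ξ i)) (hV : Measurable V) (j i : Fin N) :
    MeasurableSet (rankEvent R ξ V j i) :=
  ((measurable_pi_lambda _ hξ).prodMk hV) (R.measurableSet_perm_apply_eq j i)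

lemma measurable_inducedOrderStat (R : RankingRule N T) {ξ ζ : Fin N → Ω → ℝ} {V : Ω → T}
    (hξ : ∀ i, Measurable (ξ i)) (hζ : ∀ i, Measurable (ζ i)) (hV : Measurable V) (j : Fin N) :
    Measurable (inducedOrderStat R ξ ζ V j) := by
  have : inducedOrderStat R ξ ζ V j =
      fun ω => ∑ i, (rankEvent R ξ V j i).indicator (fun ω => ζ i ω) ω :=
    funext fun ω => comp_inducedOrderStat_eq_sum R ξ ζ V id j ω
  rw [this]
  exact Finset.measurable_sum _ fun i _ =>
    (hζ i).indicator (measurableSet_rankEvent R hξ hV j i)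

variable {P : Measure Ω}

lemma integrable_pow_inducedOrderStat (R : RankingRule N T) {ξ ζ : Fin N → Ω → ℝ} {V : Ω → T}
    (hξ : ∀ i, Measurable (ξ i)) (hV : Measurable V) {n : ℕ}
    (hint : ∀ i, Integrable (fun ω => ζ i ω ^ n) P) (j : Fin N) :
    Integrable (fun ω => inducedOrderStat R ξ ζ V j ω ^ n) P := by
  simp_rw [comp_inducedOrderStat_eq_sum R ξ ζ V (fun x => x ^ n) j]
  exact integrable_finsetSum _ fun i _ =>
    (hint i).indicator (measurableSet_rankEvent R hξ hV j i)

variable [IsProbabilityMeasure P] {ξ η : Fin N → Ω → ℝ} {V : Ω → T}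

/-- The observation `i` is independent of the other observations and the randomization. -/
lemma indepFun_pair_rest (hξ : ∀ i, Measurable (ξ i)) (hη : ∀ i, Measurable (η i))
    (hindep : iIndepFun (fun i ω => (ξ i ω, η i ω)) P) (hV : Measurable V)
    (hVindep : IndepFun V (fun ω i => (ξ i ω, η i ω)) P) (i : Fin N) :
    IndepFun (fun ω => (ξ i ω, η i ω))
      (fun ω => ((fun l : {l : Fin N // l ≠ i} => ξ l ω), V ω)) P := by
  have hZ : ∀ l, Measurable fun ω => (ξ l ω, η l ω) := fun l => (hξ l).prodMk (hη l)
  refine IndepFun.prodMk_right_of_prodMk_left (hZ i)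
    (measurable_pi_lambda _ fun l => hξ l) hV ?_ ?_
  · have h := hindep.indepFun_finset {i} (Finset.univ.erase i) (by simp) hZ
    have h1 : Measurable fun z : ({i} : Finset (Fin N)) → ℝ × ℝ =>
        z ⟨i, Finset.mem_singleton_self i⟩ := by fun_prop
    have h2 : Measurable fun (z : ↥(Finset.univ.erase i) → ℝ × ℝ)
        (l : {l : Fin N // l ≠ i}) =>
        (z ⟨l, Finset.mem_erase.2 ⟨l.2, Finset.mem_univ _⟩⟩).1 := by fun_prop
    exact h.comp h1 h2
  · exact hVindep.symm.comp
      (φ := fun z => (z i, fun l : {l : Fin N // l ≠ i} => (z l).1)) (ψ := id)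
      (by fun_prop) measurable_id

/-- If `M (ξ i)` is a version of `E[g (η i) | ξ i]`, then the concomitant `η_[j:N]` and the order
statistic `ξ_(j)` satisfy `E[g η_[j:N]] = E[M ξ_(j)]`. -/
lemma integral_comp_inducedOrderStat (R : RankingRule N T)
    (hξ : ∀ i, Measurable (ξ i)) (hη : ∀ i, Measurable (η i))
    (hindep : iIndepFun (fun i ω => (ξ i ω, η i ω)) P)
    (hident : ∀ i j, IdentDistrib (fun ω => (ξ i ω, η i ω)) (fun ω => (ξ j ω, η j ω)) P P)
    (hV : Measurable V) (hVindep : IndepFun V (fun ω i => (ξ i ω, η i ω)) P)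
    {g M : ℝ → ℝ} (hg : Measurable g) (hM : Measurable M) {C : ℝ} (hgC : ∀ x, |g x| ≤ C)
    (hMC : ∀ x, |M x| ≤ C) (i₀ : Fin N)
    (hgM : ∀ B, MeasurableSet B →
      ∫ ω in ξ i₀ ⁻¹' B, g (η i₀ ω) ∂P = ∫ ω in ξ i₀ ⁻¹' B, M (ξ i₀ ω) ∂P) (j : Fin N) :
    ∫ ω, g (inducedOrderStat R ξ η V j ω) ∂P = ∫ ω, M (inducedOrderStat R ξ ξ V j ω) ∂P := by
  have hgi : ∀ i, Integrable (fun ω => g (η i ω)) P := fun i =>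
    Integrable.of_bound (hg.comp (hη i)).aestronglyMeasurable C (ae_of_all _ fun _ => hgC _)
  have hMi : ∀ i, Integrable (fun ω => M (ξ i ω)) P := fun i =>
    Integrable.of_bound (hM.comp (hξ i)).aestronglyMeasurable C (ae_of_all _ fun _ => hMC _)
  have hE := measurableSet_rankEvent R hξ hV j
  simp_rw [comp_inducedOrderStat_eq_sum]
  rw [integral_finsetSum _ fun i _ => (hgi i).indicator (hE i),
    integral_finsetSum _ fun i _ => (hMi i).indicator (hE i)]
  refine Finset.sum_congr rfl fun i _ => ?_
  rw [← sub_eq_zero, ← integral_sub ((hgi i).indicator (hE i)) ((hMi i).indicator (hE i))]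
  -- The regression residual: it integrates to zero over events of `ξ i`, a property of the common
  -- law and hence transferable from `i₀`.
  set D : ℝ × ℝ → ℝ := fun z => g z.2 - M z.1 with hDdef
  have hD : Measurable D := by fun_prop
  have hDC : ∀ z, |D z| ≤ C + C := fun z =>
    (abs_sub _ _).trans (add_le_add (hgC _) (hMC _))
  have h0 : ∀ B, MeasurableSet B →
      ∫ z in Prod.fst ⁻¹' B, D z ∂(P.map fun ω => (ξ i ω, η i ω)) = 0 := by
    intro B hB
    rw [(hident i i₀).map_eq, setIntegral_map (measurable_fst hB) hD.aestronglyMeasurable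
      ((hξ i₀).prodMk (hη i₀)).aemeasurable]
    change ∫ ω in ξ i₀ ⁻¹' B, (g (η i₀ ω) - M (ξ i₀ ω)) ∂P = 0
    rw [integral_sub (hgi i₀).integrableOn (hMi i₀).integrableOn, hgM B hB, sub_self]
  -- Reinserting `ξ i` among the other coordinates exhibits the rank event as an event of `ξ i` and
  -- the independent rest.
  let glue : ℝ × (({l : Fin N // l ≠ i} → ℝ) × T) → (Fin N → ℝ) × T := fun p =>
    (fun l => if h : l = i then p.1 else p.2.1 ⟨l, h⟩, p.2.2)
  have hglue : Measurable glue := by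
    refine (measurable_pi_lambda _ fun l => ?_).prodMk (by fun_prop)
    by_cases h : l = i
    · simpa [h] using measurable_fst
    · simp only [h, dite_false]
      fun_prop
  have key := IndepFun.integral_indicator_eq_zero ((hξ i).prodMk (hη i))
    ((measurable_pi_lambda _ fun l : {l : Fin N // l ≠ i} => hξ l).prodMk hV)
    (indepFun_pair_rest hξ hη hindep hV hVindep i) hD hDC h0
    (hglue (R.measurableSet_perm_apply_eq j i))
  rw [← key]
  have hset : {ω | ((ξ i ω, η i ω).1, ((fun l : {l : Fin N // l ≠ i} => ξ l ω), V ω)) ∈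
      glue ⁻¹' {p | R.perm p.1 p.2 j = i}} = rankEvent R ξ V j i := by
    ext ω
    have : glue (ξ i ω, ((fun l : {l : Fin N // l ≠ i} => ξ l ω), V ω)) =
        (fun l => ξ l ω, V ω) := by
      refine Prod.ext (funext fun l => ?_) rfl
      by_cases h : l = i <;> simp [glue, h]
    simp only [Set.mem_preimage, Set.mem_ofPred_eq, this, rankEvent]
  rw [hset]
  refine integral_congr_ae (ae_of_all _ fun ω => ?_)
  by_cases h : ω ∈ rankEvent R ξ V j i <;> simp [h, hDdef]

lemma monotone_integral_comp_orderStat (R : RankingRule N T) (hξ : ∀ i, Measurable (ξ i))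
    (hV : Measurable V) {M : ℝ → ℝ} (hM : Monotone M) {C : ℝ} (hMC : ∀ x, |M x| ≤ C) :
    Monotone fun j => ∫ ω, M (inducedOrderStat R ξ ξ V j ω) ∂P := by
  have hi : ∀ j, Integrable (fun ω => M (inducedOrderStat R ξ ξ V j ω)) P := fun j =>
    Integrable.of_bound
      (hM.measurable.comp (measurable_inducedOrderStat R hξ hξ hV j)).aestronglyMeasurable C
      (ae_of_all _ fun _ => hMC _)
  intro j j' h
  exact integral_mono (hi j) (hi j') fun ω =>
    hM (R.sorted (fun i => ξ i ω) (V ω) h)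

/-- Comparison of bounded functions of concomitants, given a conditional expectation that
increases on a set carrying `ξ i₀`. -/
lemma monotone_integral_comp_inducedOrderStat (R : RankingRule N T)
    (hξ : ∀ i, Measurable (ξ i)) (hη : ∀ i, Measurable (η i))
    (hindep : iIndepFun (fun i ω => (ξ i ω, η i ω)) P)
    (hident : ∀ i j, IdentDistrib (fun ω => (ξ i ω, η i ω)) (fun ω => (ξ j ω, η j ω)) P P)
    (hV : Measurable V) (hVindep : IndepFun V (fun ω i => (ξ i ω, η i ω)) P)
    {g : ℝ → ℝ} (hg : Measurable g) {C : ℝ} (hC : 0 ≤ C) (hgC : ∀ x, |g x| ≤ C) (i₀ : Fin N)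
    {m : ℝ → ℝ} {A : Set ℝ} (hA : ∀ᵐ ω ∂P, ξ i₀ ω ∈ A) (hm : MonotoneOn m A)
    (hcond : P[fun ω => g (η i₀ ω) | MeasurableSpace.comap (ξ i₀) inferInstance]
      =ᵐ[P] fun ω => m (ξ i₀ ω)) :
    Monotone fun j => ∫ ω, g (inducedOrderStat R ξ η V j ω) ∂P := by
  obtain ⟨M, hM, hMC, hgM⟩ := exists_monotone_version_of_condExp (hξ i₀) (hg.comp (hη i₀)) hC
    (fun ω => hgC _) hA hm hcond
  simp_rw [integral_comp_inducedOrderStat R hξ hη hindep hident hV hVindep hg hM.measurable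
    hgC hMC i₀ hgM]
  exact monotone_integral_comp_orderStat R hξ hV hM hMC

end InducedOrderStat

/-! ### Reduction to bounded functions. -/

section Truncation

/-- Truncation of the real number `y` to the interval `[-n, n]`. -/
def truncate (n : ℕ) (y : ℝ) : ℝ := max (-n) (min n y)

lemma monotone_truncate (n : ℕ) : Monotone (truncate n) := fun _ _ h =>
  max_le_max le_rfl (min_le_min le_rfl h)

lemma abs_truncate_le (n : ℕ) (y : ℝ) : |truncate n y| ≤ n := by
  have : (0 : ℝ) ≤ n := n.cast_nonneg
  rw [abs_le]
  exact ⟨le_max_left _ _, max_le (by linarith) (min_le_left _ _)⟩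

lemma abs_truncate_le_abs (n : ℕ) (y : ℝ) : |truncate n y| ≤ |y| := by
  have : (0 : ℝ) ≤ n := n.cast_nonneg
  rw [abs_le]
  constructor
  · exact le_max_of_le_right (le_min (by linarith [abs_nonneg y]) (neg_abs_le y))
  · exact max_le (by linarith [abs_nonneg y]) ((min_le_right _ _).trans (le_abs_self y))

lemma tendsto_truncate (y : ℝ) :
    Filter.Tendsto (fun n => truncate n y) Filter.atTop (nhds y) := by
  refine tendsto_const_nhds.congr' ?_
  filter_upwards [Filter.eventually_ge_atTop ⌈|y|⌉₊] with n hn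
  have h := abs_le.1 (Nat.ceil_le.1 hn)
  rw [truncate, min_eq_right h.2, max_eq_right h.1]

lemma tendsto_integral_truncate {Ω : Type*} [MeasurableSpace Ω] {P : Measure Ω} {f : Ω → ℝ}
    (hf : Integrable f P) :
    Filter.Tendsto (fun n => ∫ ω, truncate n (f ω) ∂P) Filter.atTop (nhds (∫ ω, f ω ∂P)) :=
  tendsto_integral_of_dominated_convergence (fun ω => |f ω|)
    (fun n => ((monotone_truncate n).measurable.comp_aemeasurable
      hf.aemeasurable).aestronglyMeasurable)
    hf.abs (fun n => ae_of_all _ fun ω => abs_truncate_le_abs n (f ω))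
    (ae_of_all _ fun ω => tendsto_truncate (f ω))

end Truncation

theorem mainTheorem6 {Ω T : Type*} [MeasurableSpace Ω] [MeasurableSpace T]
    (P : Measure Ω) [IsProbabilityMeasure P] (N : ℕ)
    (ξ η : Fin N → Ω → ℝ) (hξ : ∀ i, Measurable (ξ i)) (hη : ∀ i, Measurable (η i))
    (hindep : iIndepFun (fun i ω => (ξ i ω, η i ω)) P)
    (hident : ∀ i j, IdentDistrib (fun ω => (ξ i ω, η i ω)) (fun ω => (ξ j ω, η j ω)) P P)
    (R : RankingRule N T) (V : Ω → T) (hV : Measurable V)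
    (hVindep : IndepFun V (fun ω i => (ξ i ω, η i ω)) P)
    (k : ℕ) :
    ((∀ i, Integrable (fun ω => η i ω ^ (2 * k + 1)) P) →
      ∀ j, Integrable (fun ω => inducedOrderStat R ξ η V j ω ^ (2 * k + 1)) P) ∧
    ((∀ i, IsPRD P (fun ω => ![ξ i ω, η i ω])) →
      MonotoneOn (fun j => ∫ ω, inducedOrderStat R ξ η V j ω ^ (2 * k + 1) ∂P)
        {j | Integrable (fun ω => inducedOrderStat R ξ η V j ω ^ (2 * k + 1)) P}) ∧
    ((∀ i, IsNRD P (fun ω => ![ξ i ω, η i ω])) →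
      AntitoneOn (fun j => ∫ ω, inducedOrderStat R ξ η V j ω ^ (2 * k + 1) ∂P)
        {j | Integrable (fun ω => inducedOrderStat R ξ η V j ω ^ (2 * k + 1)) P}) := by
  have hodd : Monotone fun x : ℝ => x ^ (2 * k + 1) :=
    (odd_two_mul_add_one k).strictMono_pow.monotone
  have hgm : ∀ n, Monotone fun x : ℝ => truncate n (x ^ (2 * k + 1)) := fun n =>
    (monotone_truncate n).comp hodd
  have hgi : ∀ n i, Integrable (fun ω => truncate n (η i ω ^ (2 * k + 1))) P := fun n i =>
    Integrable.of_bound ((hgm n).measurable.comp (hη i)).aestronglyMeasurable n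
      (ae_of_all _ fun _ => abs_truncate_le n _)
  have hGm : ∀ n, Monotone fun v : {l : Fin 2 // l ≠ 0} → ℝ =>
      truncate n (v ⟨1, one_ne_zero⟩ ^ (2 * k + 1)) := fun n v w h => hgm n (h _)
  refine ⟨fun h => integrable_pow_inducedOrderStat R hξ hV h, fun hprd => ?_, fun hnrd => ?_⟩
  · intro j hj j' hj' hjj'
    refine le_of_tendsto_of_tendsto' (tendsto_integral_truncate hj)
      (tendsto_integral_truncate hj') fun n => ?_
    -- Any observation could supply the regression function, as all have the same law; `j` is an
    -- index at hand.
    obtain ⟨m, A, hA, hm, hcond⟩ := hprd j 0 _ (hGm n) (hgi n j)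
    exact monotone_integral_comp_inducedOrderStat R hξ hη hindep hident hV hVindep
      (hgm n).measurable n.cast_nonneg (fun x => abs_truncate_le n _) j hA hm hcond hjj'
  · intro j hj j' hj' hjj'
    refine le_of_tendsto_of_tendsto' (tendsto_integral_truncate hj')
      (tendsto_integral_truncate hj) fun n => ?_
    obtain ⟨m, A, hA, hm, hcond⟩ := hnrd j 0 _ (hGm n) (hgi n j)
    -- The negated truncation has the increasing regression function `-m`; the monotonicity argument
    -- does not require `g` itself to be monotone.
    have h := monotone_integral_comp_inducedOrderStat R hξ hη hindep hident hV hVindep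
      (hgm n).measurable.neg n.cast_nonneg (fun x => by
        simpa using abs_truncate_le n (x ^ (2 * k + 1))) j hA hm.neg
      ((condExp_neg _ _).trans hcond.neg) hjj'
    simpa [integral_neg] using h
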